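/- Rank-one transformations are built by cutting and stacking, as follows. The column $C_0$ consists of the single level $[0,1)$, and $h_0=1$. Given a column $C_n$, i.e. a finite sequence of $h_n$ disjoint half-open intervals (levels) of equal length, thought of as stacked on top of each other, cut it into $r_n\ge 2$ subcolumns of equal width, put $s_{n,j}\ge 0$ new intervals (spacers) on top of the $j$-th subcolumn ($0\le j\le r_n-1$, from left to right), where each new spacer is chosen to abut the previously chosen spacer (or $[0,1)$, if it is the first one) on the right, and stack each subcolumn on top of the subcolumn to its left. This gives $C_{n+1}$, of height $h_{n+1}=\sum_{j=0}^{r_n-1}(h_n+s_{n,j})$. The rank-one transformation with cuts $r_n$ and spacers $s_{n,j}$ is the map $T$, on the union $X$ of all the columns with Lebesgue measure, that translates each level of each column, except the top one, onto the level immediately above it. It has bounded cuts if $\sup_n r_n<\infty$. It is a skyscraper transformation if $r_n=2$ and $s_{n,0}=0$ for all $n\ge 0$ and $X=[0,\infty)$. **Theorem.** Let $T$ be a rank-one transformation with bounded cuts, with cuts $r_n$, spacers $s_{n,j}$ and heights $h_n$, such that $$h_n < 2\,(h_1 + s_{1,r_1-1} + \dots + s_{n-1,r_{n-1}-1}) +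 \min_{0\le j\le r_n-2} s_{n,j} - 1 \qquad\text{for all } n\ge 2 .$$ Then there exists a rank-one skyscraper transformation $S$ such that the measure-preserving product transformation $T\times S$ is conservative but not ergodic with respect to the product of the Lebesgue measures. Here a measure-preserving transformation $R$ of $(Z,\mu)$ is conservative if for every measurable set $A$ of positive measure there are $x\in A$ and $m\ge 1$ with $R^m x\in A$, and it is ergodic if every measurable $A$ with $R^{-1}A=A$ satisfies $\mu(A)=0$ or $\mu(Z\setminus A)=0$. -/

import Mathlib

open MeasureTheory Filter Set

/-- The parameters of a cutting-and-stacking construction: at stage `n` the column `C n` is cut into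
`cuts n ≥ 2` subcolumns, and `spacers n j` spacers are put on top of the `j`-th subcolumn
(`0 ≤ j < cuts n`, counted from the left; values of `spacers n j` for `j ≥ cuts n` are not used). -/
structure CutStack where
  cuts : ℕ → ℕ
  spacers : ℕ → ℕ → ℕ
  two_le_cuts : ∀ n, 2 ≤ cuts n

namespace CutStack

noncomputable section

variable (D : CutStack)

/-- The height (number of levels) of column `C n`; `C 0` is the single level `[0,1)`. -/
def height : ℕ → ℕ
  | 0 => 1
  | n + 1 => ∑ j ∈ Finset.range (D.cuts n), (height n + D.spacers n j)

/-- The common length of the levels of column `C n`. -/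
def width : ℕ → ℝ
  | 0 => 1
  | n + 1 => width n / D.cuts n

/-- The height in `C (n+1)` of the bottom of the `j`-th subcolumn of `C n`. -/
def offset (n j : ℕ) : ℕ := ∑ k ∈ Finset.range j, (D.height n + D.spacers n k)

/-- The subcolumn of `C n` (with the spacers on top of it) that the `i`-th level of `C (n+1)`
belongs to. -/
def subcolumn (n i : ℕ) : ℕ := Nat.findGreatest (fun j => D.offset n j ≤ i) (D.cuts n - 1)

/-- The left endpoint of the `i`-th level (`0 ≤ i < height n`, from bottom to top) of `C n`.
In `C (n+1)`, let that level be number `t` (from the bottom) in the `j`-th subcolumn with its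
spacers. If `t < height n`, then it is the `j`-th piece of the `t`-th level of `C n`. Otherwise it
is a spacer. The union of the levels of `C n` is `[0, height n * width n)`, and the spacers of
stage `n` are laid out one after the other to the right of that interval, subcolumn by subcolumn
from left to right, and from bottom to top in each subcolumn. -/
def left : ℕ → ℕ → ℝ
  | 0, _ => 0
  | n + 1, i =>
    let j := D.subcolumn n i
    let t := i - D.offset n j
    if t < D.height n then
      left n t + j * D.width (n + 1)
    else
      D.height n * D.width n
        + (((∑ k ∈ Finset.range j, D.spacers n k) + (t - D.height n) : ℕ) : ℝ) * D.width (n + 1)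

/-- The `i`-th level of column `C n`, a half-open interval. -/
def level (n i : ℕ) : Set ℝ := Ico (D.left n i) (D.left n i + D.width n)

/-- The union of the levels of column `C n`. -/
def column (n : ℕ) : Set ℝ := ⋃ i ∈ Finset.range (D.height n), D.level n i

/-- The space on which the rank-one transformation is defined. -/
def space : Set ℝ := ⋃ n, D.column n

/-- Lebesgue measure on the space of the rank-one transformation. -/
def measure : Measure ℝ := volume.restrict D.space

/-- The column map of `C n`: each level except the top one is translated onto the level immediately
above it. By convention the points where the column map is not defined stay fixed. -/
def columnMap (n : ℕ) (x : ℝ) : ℝ :=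
  x + ∑ i ∈ Finset.range (D.height n - 1),
    (D.level n i).indicator (fun _ => D.left n (i + 1) - D.left n i) x

/-- The rank-one transformation: the pointwise limit of the column maps. (On `space` the sequence
is eventually constant; outside `space` the map is the identity.) -/
def map (x : ℝ) : ℝ := limUnder atTop (fun n => D.columnMap n x)

/-- Bounded cuts: `sup_n cuts n < ∞`. -/
def BoundedCuts : Prop := BddAbove (range D.cuts)

/-- The number of spacers on the last (rightmost) subcolumn at stage `n`. -/
def lastSpacers (n : ℕ) : ℕ := D.spacers n (D.cuts n - 1)

/-- The minimum of `spacers n j` over `0 ≤ j ≤ cuts n - 2`. -/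
def minSpacers (n : ℕ) : ℕ :=
  (Finset.range (D.cuts n - 1)).inf'
    (Finset.nonempty_range_iff.mpr (Nat.sub_ne_zero_of_lt (D.two_le_cuts n))) (D.spacers n)

/-- A (rank-one) skyscraper: each column is cut into two subcolumns, spacers are added on the right
subcolumn only, and the resulting space is `[0, ∞)`, of infinite measure. -/
def IsSkyscraper : Prop :=
  (∀ n, D.cuts n = 2 ∧ D.spacers n 0 = 0) ∧ D.space = Ici 0

end

end CutStack

/-! Let `span n` be the distance between the bottoms of the first and last subcolumns of `C n`. The
skyscraper `S` is given the heights `T.span (g k)` along a fast-growing sequence of stages.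

Conservativity (`conservative_prod`): at time `T.span (g k)` both maps carry a first subcolumn onto
a last one by a translation tending to zero. A set without returns therefore nearly misses the
product of the first subcolumns. As the cuts are bounded, boundedly many small translates of this
product cover the set, which must then be null.

Non-ergodicity (`not_iterate_mem_level`): no orbit leads from level 0 × level 0 of the columns `C 1`
to level 1 × level 0. Level numbers are sums of offsets (`exists_digits`), so a passage in time `m`
yields two expansions of `m` whose difference reads `∑ u n = -1`, where `u n` is a difference of
offsets of `T` minus 0 or `± span n`. Each `u n` is zero or at least `height n + minSpacers n` in
size (`offset_sub_sub_span`). The hypothesis on the heights says that this bound exceeds `2 * ∑ k <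
n, span k` by at least 2 (`two_mul_sum_span_le`), so the last nonzero term dominates and the sum
cannot be `±1` (`abs_sum_ne_one`). -/

namespace CutStack

/-! ### Columns, and their levels as cells of a grid -/

variable (D : CutStack)

lemma cuts_pos (n : ℕ) : 0 < D.cuts n := by
  have := D.two_le_cuts n
  omega

lemma offset_zero (n : ℕ) : D.offset n 0 = 0 := by
  simp [offset]

lemma offset_succ (n j : ℕ) :
    D.offset n (j + 1) = D.offset n j + (D.height n + D.spacers n j) := by
  simp [offset, Finset.sum_range_succ]

lemma height_succ (n : ℕ) : D.height (n + 1) = D.offset n (D.cuts n) := rfl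

lemma offset_mono (n : ℕ) : Monotone (D.offset n) :=
  monotone_nat_of_le_succ fun j => by rw [offset_succ]; omega

/-- The number of levels between the bottoms of the first and the last subcolumn. -/
def span (n : ℕ) : ℕ := D.offset n (D.cuts n - 1)

lemma height_succ_eq (n : ℕ) :
    D.height (n + 1) = D.span n + (D.height n + D.lastSpacers n) := by
  have h := D.cuts_pos n
  rw [height_succ, span, lastSpacers, ← offset_succ]
  congr 1
  omega

lemma height_le_span (n : ℕ) : D.height n ≤ D.span n := by
  have h : D.offset n 1 ≤ D.span n := D.offset_mono n (by have := D.two_le_cuts n; omega)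
  have h1 := D.offset_succ n 0
  simp only [zero_add, offset_zero] at h1
  omega

lemma height_pos (n : ℕ) : 0 < D.height n := by
  induction n with
  | zero => simp [height]
  | succ n ih => rw [height_succ_eq]; omega

lemma two_pow_le_height (n : ℕ) : 2 ^ n ≤ D.height n := by
  induction n with
  | zero => simp [height]
  | succ n ih =>
    have := D.height_le_span n
    rw [height_succ_eq, pow_succ]
    omega

lemma width_pos (n : ℕ) : 0 < D.width n := by
  induction n with
  | zero => simp [width]
  | succ n ih => exact div_pos ih (by exact_mod_cast D.cuts_pos n)

lemma cuts_mul_width_succ (n : ℕ) : D.cuts n * D.width (n + 1) = D.width n := by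
  have : (D.cuts n : ℝ) ≠ 0 := by exact_mod_cast (D.cuts_pos n).ne'
  rw [width]
  field_simp

lemma width_le (n : ℕ) : D.width n ≤ (1 / 2) ^ n := by
  induction n with
  | zero => simp [width]
  | succ n ih =>
    have h2 : (2 : ℝ) ≤ D.cuts n := by exact_mod_cast D.two_le_cuts n
    rw [width, pow_succ, mul_one_div]
    exact div_le_div₀ (by positivity) ih (by norm_num) h2

lemma tendsto_width : Tendsto D.width atTop (nhds 0) :=
  squeeze_zero (fun n => (D.width_pos n).le) D.width_le
    (tendsto_pow_atTop_nhds_zero_of_lt_one (by norm_num) (by norm_num))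

lemma offset_add_lt {n j t : ℕ} (hj : j < D.cuts n) (ht : t < D.height n + D.spacers n j) :
    D.offset n j + t < D.height (n + 1) := by
  have := D.offset_mono n (Nat.succ_le_of_lt hj)
  rw [height_succ]
  rw [Nat.succ_eq_add_one, offset_succ] at this
  omega

lemma subcolumn_offset_add {n j t : ℕ} (hj : j < D.cuts n)
    (ht : t < D.height n + D.spacers n j) : D.subcolumn n (D.offset n j + t) = j := by
  rw [subcolumn, Nat.findGreatest_eq_iff]
  refine ⟨by omega, fun _ => by omega, fun k hk _ => ?_⟩
  have := D.offset_mono n (Nat.succ_le_of_lt hk)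
  rw [Nat.succ_eq_add_one, offset_succ] at this
  omega

lemma exists_offset_add {n i : ℕ} (hi : i < D.height (n + 1)) :
    ∃ j < D.cuts n, ∃ t < D.height n + D.spacers n j, i = D.offset n j + t := by
  have key : ∀ c, i < D.offset n c →
      ∃ j < c, ∃ t < D.height n + D.spacers n j, i = D.offset n j + t := by
    intro c
    induction c with
    | zero => intro h; simp [offset_zero] at h
    | succ c ih =>
      intro h
      by_cases hc : i < D.offset n c
      · obtain ⟨j, hj, h'⟩ := ih hc
        exact ⟨j, by omega, h'⟩
      · rw [offset_succ] at h
        exact ⟨c, by omega, i - D.offset n c, by omega, by omega⟩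
  exact key _ hi

lemma left_offset_add {n j t : ℕ} (hj : j < D.cuts n) (ht : t < D.height n) :
    D.left (n + 1) (D.offset n j + t) = D.left n t + j * D.width (n + 1) := by
  simp only [left]
  rw [D.subcolumn_offset_add hj (by omega), Nat.add_sub_cancel_left, if_pos ht]

/-- The number of levels of `C n` to the left of the `i`-th one. -/
def pos : ℕ → ℕ → ℕ
  | 0, _ => 0
  | n + 1, i =>
    let j := D.subcolumn n i
    let t := i - D.offset n j
    if t < D.height n then
      D.cuts n * pos n t + j
    else
      D.cuts n * D.height n + ((∑ k ∈ Finset.range j, D.spacers n k) + (t - D.height n))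

/-- Puts the levels on the grid of step `width n`; disjointness of levels and the shape of a column
then become facts about the integers `pos n i`. -/
lemma left_eq (n i : ℕ) : D.left n i = D.pos n i * D.width n := by
  induction n generalizing i with
  | zero => simp [left, pos]
  | succ n ih =>
    simp only [left, pos]
    split_ifs
    · rw [ih, ← D.cuts_mul_width_succ n]
      push_cast
      ring
    · rw [← D.cuts_mul_width_succ n]
      push_cast
      ring

lemma offset_eq (n j : ℕ) :
    D.offset n j = j * D.height n + ∑ k ∈ Finset.range j, D.spacers n k := by
  simp [offset, Finset.sum_add_distrib]

lemma pos_lt (n : ℕ) : ∀ i < D.height n, D.pos n i < D.height n := by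
  induction n with
  | zero => simp [pos, height]
  | succ n ih =>
    intro i hi
    obtain ⟨j, hj, t, ht, rfl⟩ := D.exists_offset_add hi
    have hs := Finset.sum_range_succ (D.spacers n) j
    have hm : ∑ k ∈ Finset.range (j + 1), D.spacers n k
        ≤ ∑ k ∈ Finset.range (D.cuts n), D.spacers n k :=
      Finset.sum_le_sum_of_subset (Finset.range_mono hj)
    simp only [pos]
    rw [D.subcolumn_offset_add hj ht, Nat.add_sub_cancel_left, height_succ, offset_eq]
    split_ifs with h
    · have : D.cuts n * (D.pos n t + 1) ≤ D.cuts n * D.height n :=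
        Nat.mul_le_mul_left _ (ih t h)
      rw [mul_add] at this
      omega
    · omega

/-- Pieces of old levels are recovered from quotient and remainder by `cuts n`; spacers come after
all of them, in the order of their creation. -/
lemma pos_injOn (n : ℕ) : InjOn (D.pos n) (Iio (D.height n)) := by
  induction n with
  | zero =>
    intro i hi j hj _
    simp only [height, mem_Iio] at hi hj
    omega
  | succ n ih =>
    intro i hi i' hi' h
    obtain ⟨j, hj, t, ht, rfl⟩ := D.exists_offset_add hi
    obtain ⟨j', hj', t', ht', rfl⟩ := D.exists_offset_add hi'
    simp only [pos] at h
    rw [D.subcolumn_offset_add hj ht, D.subcolumn_offset_add hj' ht', Nat.add_sub_cancel_left,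
      Nat.add_sub_cancel_left] at h
    have bound : ∀ j < D.cuts n, ∀ t < D.height n,
        D.cuts n * D.pos n t + j < D.cuts n * D.height n := fun j hj t ht => by
      have : D.cuts n * (D.pos n t + 1) ≤ D.cuts n * D.height n :=
        Nat.mul_le_mul_left _ (D.pos_lt n t ht)
      rw [mul_add] at this
      omega
    split_ifs at h with h1 h2 h2
    · have e1 := congrArg (· % D.cuts n) h
      have e2 := congrArg (· / D.cuts n) h
      simp only [Nat.mul_add_mod, Nat.mod_eq_of_lt hj, Nat.mod_eq_of_lt hj'] at e1
      simp only [Nat.mul_add_div (D.cuts_pos n), Nat.div_eq_of_lt hj, Nat.div_eq_of_lt hj',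
        add_zero] at e2
      rw [e1, ih h1 h2 e2]
    · have := bound j hj t h1
      omega
    · have := bound j' hj' t' h2
      omega
    · have mono : ∀ a b, a < b → ∑ k ∈ Finset.range (a + 1), D.spacers n k
          ≤ ∑ k ∈ Finset.range b, D.spacers n k := fun a b hab =>
        Finset.sum_le_sum_of_subset (Finset.range_mono hab)
      have s1 := Finset.sum_range_succ (D.spacers n) j
      have s2 := Finset.sum_range_succ (D.spacers n) j'
      rcases lt_trichotomy j j' with hjj | hjj | hjj
      · have := mono _ _ hjj
        omega
      · subst hjj
        omega
      · have := mono _ _ hjj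
        omega

lemma exists_pos_eq {n k : ℕ} (hk : k < D.height n) : ∃ i < D.height n, D.pos n i = k := by
  have h := Finset.surjOn_of_injOn_of_card_le (s := Finset.range (D.height n))
    (t := Finset.range (D.height n)) (D.pos n)
    (fun i hi => by simpa using D.pos_lt n i (by simpa using hi))
    (by simpa using D.pos_injOn n) le_rfl
  obtain ⟨i, hi, h⟩ := h (by simpa using hk : k ∈ (Finset.range (D.height n) : Set ℕ))
  exact ⟨i, by simpa using hi, h⟩

lemma mem_level_iff {n i : ℕ} {x : ℝ} (hx : 0 ≤ x) :
    x ∈ D.level n i ↔ ⌊x / D.width n⌋₊ = D.pos n i := by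
  have hw := D.width_pos n
  rw [Nat.floor_eq_iff (by positivity), level, left_eq, mem_Ico, le_div_iff₀ hw, div_lt_iff₀ hw,
    add_mul, one_mul]

lemma nonneg_of_mem_level {n i : ℕ} {x : ℝ} (hx : x ∈ D.level n i) : 0 ≤ x := by
  refine le_trans ?_ hx.1
  rw [left_eq]
  have := D.width_pos n
  positivity

lemma level_index_unique {n i i' : ℕ} {x : ℝ} (hi : i < D.height n) (hi' : i' < D.height n)
    (hx : x ∈ D.level n i) (hx' : x ∈ D.level n i') : i = i' := by
  have h0 := D.nonneg_of_mem_level hx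
  rw [D.mem_level_iff h0] at hx hx'
  exact D.pos_injOn n hi hi' (hx.symm.trans hx')

lemma mem_column_iff {n : ℕ} {x : ℝ} :
    x ∈ D.column n ↔ ∃ i < D.height n, x ∈ D.level n i := by
  simp [column]

lemma column_eq (n : ℕ) : D.column n = Ico 0 (D.height n * D.width n) := by
  have hw := D.width_pos n
  ext x
  rw [mem_column_iff]
  constructor
  · rintro ⟨i, hi, hx⟩
    have h0 := D.nonneg_of_mem_level hx
    refine ⟨h0, ?_⟩
    rw [D.mem_level_iff h0] at hx
    rw [← div_lt_iff₀ hw, ← Nat.floor_lt (by positivity), hx]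
    exact D.pos_lt n i hi
  · rintro ⟨h0, h1⟩
    rw [← div_lt_iff₀ hw, ← Nat.floor_lt (by positivity)] at h1
    obtain ⟨i, hi, h⟩ := D.exists_pos_eq h1
    exact ⟨i, hi, (D.mem_level_iff h0).2 h.symm⟩

lemma column_mono : Monotone D.column := by
  refine monotone_nat_of_le_succ fun n => ?_
  rw [column_eq, column_eq]
  refine Ico_subset_Ico_right ?_
  rw [← D.cuts_mul_width_succ n, ← mul_assoc]
  refine mul_le_mul_of_nonneg_right ?_ (D.width_pos _).le
  rw [height_succ, offset_eq]
  push_cast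
  nlinarith [Finset.sum_nonneg fun k (_ : k ∈ Finset.range (D.cuts n)) =>
    (D.spacers n k).cast_nonneg (α := ℝ)]

lemma exists_mem_level_succ {n t : ℕ} {x : ℝ} (ht : t < D.height n) (hx : x ∈ D.level n t) :
    ∃ j < D.cuts n, x ∈ D.level (n + 1) (D.offset n j + t) := by
  have hw := D.width_pos (n + 1)
  have hc := D.cuts_mul_width_succ n
  obtain ⟨h1, h2⟩ := hx
  have h0 : 0 ≤ (x - D.left n t) / D.width (n + 1) := div_nonneg (by linarith) hw.le
  refine ⟨⌊(x - D.left n t) / D.width (n + 1)⌋₊, ?_, ?_⟩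
  · rw [Nat.floor_lt h0, div_lt_iff₀ hw]
    linarith
  · have hj : ⌊(x - D.left n t) / D.width (n + 1)⌋₊ < D.cuts n := by
      rw [Nat.floor_lt h0, div_lt_iff₀ hw]
      linarith
    have e1 := Nat.floor_le h0
    have e2 := Nat.lt_floor_add_one ((x - D.left n t) / D.width (n + 1))
    rw [le_div_iff₀ hw] at e1
    rw [div_lt_iff₀ hw] at e2
    rw [level, D.left_offset_add hj ht]
    constructor <;> linarith

lemma measurableSet_level (n i : ℕ) : MeasurableSet (D.level n i) := measurableSet_Ico

lemma measurableSet_column (n : ℕ) : MeasurableSet (D.column n) := by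
  rw [column_eq]
  exact measurableSet_Ico

lemma measurableSet_space : MeasurableSet D.space :=
  MeasurableSet.iUnion D.measurableSet_column

lemma column_subset_space (n : ℕ) : D.column n ⊆ D.space := subset_iUnion _ _

lemma volume_level (n i : ℕ) : volume (D.level n i) = ENNReal.ofReal (D.width n) := by
  simp [level]

end CutStack

/-! ### The map is well defined and measure-preserving -/

namespace CutStack

variable (D : CutStack)

lemma columnMap_of_mem {n i : ℕ} {x : ℝ} (hi : i + 1 < D.height n) (hx : x ∈ D.level n i) :
    D.columnMap n x = x + (D.left n (i + 1) - D.left n i) := by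
  rw [columnMap, Finset.sum_eq_single i, indicator_of_mem hx]
  · intro k hk hki
    refine indicator_of_notMem (fun h => hki ?_) _
    exact D.level_index_unique (by simp at hk; omega) (by omega) h hx
  · intro h
    simp at h
    omega

lemma columnMap_of_notMem {n : ℕ} {x : ℝ} (hx : x ∉ D.column n) : D.columnMap n x = x := by
  rw [columnMap, Finset.sum_eq_zero, add_zero]
  intro k hk
  refine indicator_of_notMem (fun h => hx ?_) _
  exact D.mem_column_iff.2 ⟨k, by simp at hk; omega, h⟩

/-- Each subcolumn repeats `C n` up to a common translation, so the gap between consecutive levels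
persists. -/
lemma columnMap_eq_of_le {n i N : ℕ} {x : ℝ} (hi : i + 1 < D.height n) (hx : x ∈ D.level n i)
    (hN : n ≤ N) : D.columnMap N x = x + (D.left n (i + 1) - D.left n i) := by
  have key : ∃ k, k + 1 < D.height N ∧ x ∈ D.level N k ∧
      D.left N (k + 1) - D.left N k = D.left n (i + 1) - D.left n i := by
    induction N, hN using Nat.le_induction with
    | base => exact ⟨i, hi, hx, rfl⟩
    | succ N _ ih =>
      obtain ⟨k, hk, hxk, he⟩ := ih
      obtain ⟨j, hj, hxj⟩ := D.exists_mem_level_succ (by omega) hxk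
      refine ⟨D.offset N j + k, ?_, hxj, ?_⟩
      · rw [add_assoc]
        exact D.offset_add_lt hj (by omega)
      · rw [add_assoc, D.left_offset_add hj hk, D.left_offset_add hj (by omega), ← he]
        ring
  obtain ⟨k, hk, hxk, he⟩ := key
  rw [D.columnMap_of_mem hk hxk, he]

lemma tendsto_columnMap_of_mem {n i : ℕ} {x : ℝ} (hi : i + 1 < D.height n)
    (hx : x ∈ D.level n i) :
    Tendsto (fun N => D.columnMap N x) atTop (nhds (x + (D.left n (i + 1) - D.left n i))) :=
  tendsto_const_nhds.congr' ((eventually_ge_atTop n).mono fun _ hN =>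
    (D.columnMap_eq_of_le hi hx hN).symm)

lemma map_of_mem {n i : ℕ} {x : ℝ} (hi : i + 1 < D.height n) (hx : x ∈ D.level n i) :
    D.map x = x + (D.left n (i + 1) - D.left n i) :=
  (D.tendsto_columnMap_of_mem hi hx).limUnder_eq

lemma map_mem_level {n i : ℕ} {x : ℝ} (hi : i + 1 < D.height n) (hx : x ∈ D.level n i) :
    D.map x ∈ D.level n (i + 1) := by
  rw [D.map_of_mem hi hx]
  constructor <;> linarith [hx.1, hx.2]

lemma iterate_map_of_mem {n i : ℕ} {x : ℝ} (hx : x ∈ D.level n i) (m : ℕ)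
    (hi : i + m < D.height n) :
    D.map^[m] x = x + (D.left n (i + m) - D.left n i) ∧ D.map^[m] x ∈ D.level n (i + m) := by
  induction m with
  | zero => simpa using hx
  | succ m ih =>
    obtain ⟨h1, h2⟩ := ih (by omega)
    rw [Function.iterate_succ_apply']
    refine ⟨?_, D.map_mem_level (by omega) h2⟩
    rw [D.map_of_mem (by omega) h2, h1, add_assoc i m 1]
    ring

lemma exists_mem_level_of_le {n N : ℕ} {x : ℝ} (hx : x ∈ D.column n) (hN : n ≤ N) :
    ∃ i < D.height N, x ∈ D.level N i :=
  D.mem_column_iff.1 (D.column_mono hN hx)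

/-- A point that is not in the top level of a column is not in the top level of later columns. -/
lemma exists_mem_level_not_top_of_le {n i m N : ℕ} {x : ℝ} (hi : i + m < D.height n)
    (hx : x ∈ D.level n i) (hN : n ≤ N) : ∃ k, k + m < D.height N ∧ x ∈ D.level N k := by
  induction N, hN using Nat.le_induction with
  | base => exact ⟨i, hi, hx⟩
  | succ N _ ih =>
    obtain ⟨k, hk, hxk⟩ := ih
    obtain ⟨j, hj, hxj⟩ := D.exists_mem_level_succ (by omega) hxk
    refine ⟨D.offset N j + k, ?_, hxj⟩
    rw [add_assoc]
    exact D.offset_add_lt hj (by omega)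

/-- Every point of the space leaves the top levels eventually. -/
lemma exists_mem_level_not_top {x : ℝ} (hx : x ∈ D.space) :
    ∃ n i, i + 1 < D.height n ∧ x ∈ D.level n i := by
  by_contra! hcon
  obtain ⟨n, hn⟩ := mem_iUnion.1 hx
  have top : ∀ N ≥ n, x ∈ D.level N (D.height N - 1) := fun N hN => by
    obtain ⟨i, hi, hxi⟩ := D.exists_mem_level_of_le hn hN
    have : ¬ i + 1 < D.height N := fun h => hcon N i h hxi
    rwa [show D.height N - 1 = i by omega]
  -- A point always in the top level is always in its rightmost piece. These intervals share their
  -- right endpoint and shrink to it, but being half-open they omit it.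
  have right : ∀ N ≥ n, D.left N (D.height N - 1) + D.width N
      = D.left n (D.height n - 1) + D.width n := fun N hN => by
    induction N, hN using Nat.le_induction with
    | base => rfl
    | succ N hN ih =>
      have hh := D.height_pos N
      have hh' := D.height_pos (N + 1)
      obtain ⟨j, hj, hxj⟩ := D.exists_mem_level_succ (by omega) (top N hN)
      have e := D.level_index_unique (D.offset_add_lt hj (by omega)) (by omega) hxj
        (top (N + 1) (by omega))
      have hjr : j + 1 = D.cuts N := by
        by_contra hne
        have h1 := D.offset_add_lt (n := N) (j := j + 1) (t := 0) (by omega) (by omega)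
        rw [offset_succ] at h1
        omega
      rw [← ih, ← e, D.left_offset_add hj (by omega), ← D.cuts_mul_width_succ N, ← hjr]
      push_cast
      ring
  have hpos : 0 < D.left n (D.height n - 1) + D.width n - x := by
    have := (top n le_rfl).2
    linarith
  obtain ⟨N, hN, hNn⟩ := ((D.tendsto_width.eventually_lt_const hpos).and
    (eventually_ge_atTop n)).exists
  have h1 := right N hNn
  have h2 := (top N hNn).1
  linarith

lemma map_mem_space {x : ℝ} (hx : x ∈ D.space) : D.map x ∈ D.space := by
  obtain ⟨n, i, hi, hxi⟩ := D.exists_mem_level_not_top hx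
  exact D.column_subset_space n (D.mem_column_iff.2 ⟨i + 1, hi, D.map_mem_level hi hxi⟩)

lemma exists_mem_level_add_lt {x : ℝ} (hx : x ∈ D.space) (m : ℕ) :
    ∃ n i, i + m < D.height n ∧ x ∈ D.level n i := by
  induction m generalizing x with
  | zero =>
    obtain ⟨n, i, hi, hxi⟩ := D.exists_mem_level_not_top hx
    exact ⟨n, i, by omega, hxi⟩
  | succ m ih =>
    obtain ⟨n, i, hi, hxi⟩ := D.exists_mem_level_not_top hx
    obtain ⟨n', i', hi', hxi'⟩ := ih (D.map_mem_space hx)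
    obtain ⟨k, hk, hxk⟩ := D.exists_mem_level_not_top_of_le hi hxi (le_max_left n n')
    obtain ⟨k', hk', hxk'⟩ := D.exists_mem_level_not_top_of_le hi' hxi' (le_max_right n n')
    have := D.level_index_unique (by omega) (by omega) hxk' (D.map_mem_level hk hxk)
    exact ⟨_, k, by omega, hxk⟩

lemma map_of_notMem {x : ℝ} (hx : x ∉ D.space) : D.map x = x := by
  have : ∀ n, D.columnMap n x = x := fun n =>
    D.columnMap_of_notMem fun h => hx (D.column_subset_space n h)
  simp only [map, this]
  exact tendsto_const_nhds.limUnder_eq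

lemma measurable_columnMap (n : ℕ) : Measurable (D.columnMap n) :=
  measurable_id.add (Finset.measurable_fun_sum _ fun i _ =>
    measurable_const.indicator (D.measurableSet_level n i))

lemma measurable_map : Measurable D.map := by
  refine measurable_of_tendsto_metrizable D.measurable_columnMap (tendsto_pi_nhds.2 fun x => ?_)
  by_cases hx : x ∈ D.space
  · obtain ⟨n, i, hi, hxi⟩ := D.exists_mem_level_not_top hx
    rw [D.map_of_mem hi hxi]
    exact D.tendsto_columnMap_of_mem hi hxi
  · rw [D.map_of_notMem hx]
    refine tendsto_const_nhds.congr fun n => ?_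
    exact (D.columnMap_of_notMem fun h => hx (D.column_subset_space n h)).symm

lemma volume_preimage_map_inter_level {n i : ℕ} (hi : i + 1 < D.height n) (B : Set ℝ) :
    volume (D.map ⁻¹' B ∩ D.level n i) = volume (B ∩ D.level n (i + 1)) := by
  have : D.map ⁻¹' B ∩ D.level n i
      = (fun x => x + (D.left n (i + 1) - D.left n i)) ⁻¹' (B ∩ D.level n (i + 1)) := by
    ext x
    simp only [mem_inter_iff, mem_preimage]
    have hl : x ∈ D.level n i ↔ x + (D.left n (i + 1) - D.left n i) ∈ D.level n (i + 1) := by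
      simp only [level, mem_Ico]
      constructor <;> rintro ⟨h1, h2⟩ <;> constructor <;> linarith
    rw [← hl]
    refine and_congr_left fun hx => ?_
    rw [D.map_of_mem hi hx]
  rw [this, measure_preimage_add_right]

lemma volume_inter_column {n : ℕ} {B : Set ℝ} (hB : MeasurableSet B) :
    volume (B ∩ D.column n) = ∑ i ∈ Finset.range (D.height n), volume (B ∩ D.level n i) := by
  rw [column, inter_iUnion₂]
  refine measure_biUnion_finset (fun i hi k hk hik => ?_)
    fun i _ => hB.inter (D.measurableSet_level n i)
  refine disjoint_left.2 fun x hxi hxk => hik ?_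
  exact D.level_index_unique (by simpa using hi) (by simpa using hk) hxi.2 hxk.2

/-- Only the top level of the preimage and the bottom level of `B` remain unmatched, and each costs
at most one width. -/
lemma volume_preimage_map_inter_column (n : ℕ) {B : Set ℝ} (hB : MeasurableSet B) :
    volume (D.map ⁻¹' B ∩ D.column n) ≤ volume (B ∩ D.column n) + ENNReal.ofReal (D.width n) ∧
    volume (B ∩ D.column n) ≤ volume (D.map ⁻¹' B ∩ D.column n) + ENNReal.ofReal (D.width n) := by
  obtain ⟨h, hh⟩ : ∃ h, D.height n = h + 1 := ⟨D.height n - 1, by have := D.height_pos n; omega⟩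
  have hs : ∑ i ∈ Finset.range h, volume (D.map ⁻¹' B ∩ D.level n i)
      = ∑ i ∈ Finset.range h, volume (B ∩ D.level n (i + 1)) :=
    Finset.sum_congr rfl fun i hi => D.volume_preimage_map_inter_level
      (by simp at hi; omega) B
  have hl : ∀ (B : Set ℝ) i, volume (B ∩ D.level n i) ≤ ENNReal.ofReal (D.width n) :=
    fun B i => (measure_mono inter_subset_right).trans (D.volume_level n i).le
  rw [D.volume_inter_column (D.measurable_map hB), D.volume_inter_column hB, hh]
  constructor
  · rw [Finset.sum_range_succ, hs, Finset.sum_range_succ' _ h]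
    exact add_le_add le_self_add (hl _ _)
  · rw [Finset.sum_range_succ', Finset.sum_range_succ _ h, hs]
    exact add_le_add le_self_add (hl _ _)

lemma tendsto_volume_inter_column (B : Set ℝ) :
    Tendsto (fun n => volume (B ∩ D.column n)) atTop (nhds (volume (B ∩ D.space))) := by
  rw [space, inter_iUnion]
  exact tendsto_measure_iUnion_atTop fun i j h => inter_subset_inter_right _ (D.column_mono h)

lemma measurePreserving_map : MeasurePreserving D.map D.measure D.measure := by
  refine ⟨D.measurable_map, Measure.ext fun B hB => ?_⟩
  rw [Measure.map_apply D.measurable_map hB, measure,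
    Measure.restrict_apply' D.measurableSet_space, Measure.restrict_apply' D.measurableSet_space]
  have hw : Tendsto (fun n => ENNReal.ofReal (D.width n)) atTop (nhds 0) := by
    simpa using ENNReal.tendsto_ofReal D.tendsto_width
  have h1 := D.tendsto_volume_inter_column (D.map ⁻¹' B)
  have h2 := D.tendsto_volume_inter_column B
  refine le_antisymm ?_ ?_
  · refine le_of_tendsto_of_tendsto' h1 ?_ fun n => (D.volume_preimage_map_inter_column n hB).1
    simpa using h2.add hw
  · refine le_of_tendsto_of_tendsto' h2 ?_ fun n => (D.volume_preimage_map_inter_column n hB).2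
    simpa using h1.add hw

end CutStack

/-! ### Arithmetic of the offsets -/

lemma abs_sum_ne_one {q Δ u : ℕ → ℤ}
    (hq : ∀ n, 1 ≤ n → 2 * ∑ k ∈ Finset.Ico 1 n, Δ k + 2 ≤ q n)
    (hu : ∀ n, |u n| ≤ 2 * Δ n) (hu' : ∀ n, u n = 0 ∨ q n ≤ |u n|) (N : ℕ) :
    |∑ n ∈ Finset.Ico 1 N, u n| ≠ 1 := by
  rcases Nat.eq_zero_or_pos N with rfl | hN
  · simp
  -- A nonzero `u N` exceeds the largest possible earlier sum by at least 2, so the dichotomy "zero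
  -- or at least 2" propagates.
  have key : |∑ n ∈ Finset.Ico 1 N, u n| ≤ 2 * ∑ n ∈ Finset.Ico 1 N, Δ n ∧
      (∑ n ∈ Finset.Ico 1 N, u n = 0 ∨ 2 ≤ |∑ n ∈ Finset.Ico 1 N, u n|) := by
    induction N, hN using Nat.le_induction with
    | base => simp
    | succ N hN ih =>
      obtain ⟨h1, h2⟩ := ih
      rw [Finset.sum_Ico_succ_top hN, Finset.sum_Ico_succ_top hN]
      refine ⟨(abs_add_le _ _).trans (by linarith [hu N]), ?_⟩
      rcases hu' N with h | h
      · rwa [h, add_zero]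
      · right
        have h3 := abs_sub_abs_le_abs_add (u N) (∑ n ∈ Finset.Ico 1 N, u n)
        rw [add_comm]
        linarith [hq N hN]
  rcases key.2 with h | h
  · simp [h]
  · omega

namespace CutStack

variable (D : CutStack)

lemma minSpacers_le {n j : ℕ} (hj : j + 1 < D.cuts n) : D.minSpacers n ≤ D.spacers n j :=
  Finset.inf'_le _ (by simp; omega)

lemma offset_gap {n j j' : ℕ} (hjj : j < j') (hj' : j' < D.cuts n) :
    D.offset n j + (D.height n + D.minSpacers n) ≤ D.offset n j' := by
  have h1 := D.offset_mono n (Nat.succ_le_of_lt hjj)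
  have h2 := D.minSpacers_le (n := n) (j := j) (by omega)
  rw [Nat.succ_eq_add_one, offset_succ] at h1
  omega

lemma offset_le_span {n j : ℕ} (hj : j < D.cuts n) : D.offset n j ≤ D.span n :=
  D.offset_mono n (by omega)

/-- Offsets lie in `[0, span n]`, include both endpoints, and are separated by at least `height n +
minSpacers n`. Subtracting `± span n` gives zero only for the two extreme subcolumns; otherwise at
least one full gap is missing. -/
lemma offset_sub_sub_span {n j j' : ℕ} (hj : j < D.cuts n) (hj' : j' < D.cuts n) {c c' : ℕ}
    (hc : c ≤ 1) (hc' : c' ≤ 1) {u : ℤ}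
    (hu : u = (D.offset n j' - D.offset n j : ℤ) - (c' * D.span n - c * D.span n)) :
    |u| ≤ 2 * D.span n ∧ (u = 0 ∨ (D.height n + D.minSpacers n : ℤ) ≤ |u|) := by
  have l1 := D.offset_le_span hj
  have l2 := D.offset_le_span hj'
  have z0 := D.offset_zero n
  have hcut := D.two_le_cuts n
  have b0 : ∀ i, i < D.cuts n → i = 0 ∨ D.height n + D.minSpacers n ≤ D.offset n i := by
    intro i hi
    rcases Nat.eq_zero_or_pos i with h | h
    · exact Or.inl h
    · have := D.offset_gap h hi
      right
      omega
  have b1 : ∀ i, i < D.cuts n → i = D.cuts n - 1 ∨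
      D.offset n i + (D.height n + D.minSpacers n) ≤ D.span n := by
    intro i hi
    by_cases h : i = D.cuts n - 1
    · exact Or.inl h
    · exact Or.inr (D.offset_gap (by omega) (by omega))
  have e : D.offset n (D.cuts n - 1) = D.span n := rfl
  have b2 : j = j' ∨ D.offset n j + (D.height n + D.minSpacers n) ≤ D.offset n j' ∨
      D.offset n j' + (D.height n + D.minSpacers n) ≤ D.offset n j := by
    rcases lt_trichotomy j j' with h | h | h
    · exact Or.inr (Or.inl (D.offset_gap h hj'))
    · exact Or.inl h
    · exact Or.inr (Or.inr (D.offset_gap h hj))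
  have p1 := b0 j hj
  have p2 := b0 j' hj'
  have p3 := b1 j hj
  have p4 := b1 j' hj'
  have o1 : j = j' → D.offset n j = D.offset n j' := fun h => by rw [h]
  have o2 : j = 0 → D.offset n j = 0 := fun h => by rw [h, z0]
  have o3 : j' = 0 → D.offset n j' = 0 := fun h => by rw [h, z0]
  have o4 : j = D.cuts n - 1 → D.offset n j = D.span n := fun h => by rw [h, e]
  have o5 : j' = D.cuts n - 1 → D.offset n j' = D.span n := fun h => by rw [h, e]
  rw [← Nat.cast_add]
  generalize D.offset n j = a at *
  generalize D.offset n j' = b at *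
  generalize D.span n = s at *
  generalize D.height n + D.minSpacers n = q at *
  have habs := abs_cases u
  interval_cases c <;> interval_cases c' <;> omega

/-- The digit `j k` records the subcolumn of `C k` containing the point, which is never in a spacer
added after `C 1`. -/
lemma exists_digits {a N i : ℕ} {x : ℝ} (ha : a < D.height 1) (hx : x ∈ D.level 1 a)
    (hN : 1 ≤ N) (hi : i < D.height N) (hxi : x ∈ D.level N i) :
    ∃ j : ℕ → ℕ, (∀ k, j k < D.cuts k) ∧ i = a + ∑ k ∈ Finset.Ico 1 N, D.offset k (j k) := by
  induction N, hN using Nat.le_induction generalizing i with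
  | base =>
    exact ⟨fun _ => 0, D.cuts_pos, by simpa using D.level_index_unique hi ha hxi hx⟩
  | succ N hN ih =>
    obtain ⟨k, hk, hxk⟩ := D.exists_mem_level_of_le (D.mem_column_iff.2 ⟨a, ha, hx⟩) hN
    obtain ⟨j, hj, he⟩ := ih hk hxk
    obtain ⟨l, hl, hxl⟩ := D.exists_mem_level_succ hk hxk
    refine ⟨Function.update j N l, fun n => ?_, ?_⟩
    · by_cases h : n = N
      · subst h
        simpa using hl
      · simpa [h] using hj n
    · rw [D.level_index_unique hi (D.offset_add_lt hl (by omega)) hxi hxl,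
        Finset.sum_Ico_succ_top hN, Function.update_self, he,
        Finset.sum_congr rfl fun n hn => ?_]
      · ring
      · rw [Function.update_of_ne (by simp at hn; omega)]

lemma two_mul_sum_span_le (hT : ∀ n : ℕ, 2 ≤ n → (D.height n : ℤ) <
      2 * ((D.height 1 : ℤ) + ∑ k ∈ Finset.Ico 1 n, (D.lastSpacers k : ℤ))
        + (D.minSpacers n : ℤ) - 1) (n : ℕ) (hn : 1 ≤ n) :
    2 * ∑ k ∈ Finset.Ico 1 n, (D.span k : ℤ) + 2 ≤ D.height n + D.minSpacers n := by
  -- Telescoping `height_succ_eq` turns the hypothesis, stated with last spacers, into one about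
  -- spans.
  have hsum : (D.height n : ℤ) = D.height 1 + (∑ k ∈ Finset.Ico 1 n, (D.span k : ℤ)
      + ∑ k ∈ Finset.Ico 1 n, (D.lastSpacers k : ℤ)) := by
    clear hT
    induction n, hn using Nat.le_induction with
    | base => simp
    | succ n hn ih =>
      rw [Finset.sum_Ico_succ_top hn, Finset.sum_Ico_succ_top hn, D.height_succ_eq]
      push_cast
      rw [ih]
      ring
  rcases hn.eq_or_lt with rfl | h2
  · have := D.two_pow_le_height 1
    simp
    omega
  · have := hT n h2
    linarith

/-! ### Non-ergodicity of the product -/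

section Skyscraper

variable {T S : CutStack} {g : ℕ → ℕ}

/-- The digits of `S` are 0 or 1 with weights `S.height k = T.span (g (k - 1))`, so its expansions
can be indexed by the stages of `T`. -/
lemma exists_sum_offset_eq (hS : ∀ n, S.cuts n = 2 ∧ S.spacers n 0 = 0) (hg : StrictMono g)
    (hg0 : 1 ≤ g 0) (hheight : ∀ k, S.height (k + 1) = T.span (g k)) {e : ℕ → ℕ}
    (he : ∀ k, e k < S.cuts k) {K N : ℕ} (hN : g K ≤ N) :
    ∃ c : ℕ → ℕ, (∀ n, c n ≤ 1) ∧ ∑ k ∈ Finset.Ico 1 (K + 1), S.offset k (e k)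
      = ∑ n ∈ Finset.Ico 1 N, c n * T.span n := by
  have he' : ∀ k, e k ≤ 1 := fun k => by
    have := he k
    rw [(hS k).1] at this
    omega
  have hoff : ∀ k, S.offset k (e k) = e k * S.height k := fun k => by
    have h := he' k
    interval_cases hk : e k
    · simp [offset_zero]
    · simpa [offset_zero, (hS k).2] using S.offset_succ k 0
  let c₀ : ℕ → ℕ := fun l => if l < K then e (l + 1) else 0
  -- The coefficient is zero at stages outside the range of `g` and from `g K` on.
  refine ⟨Function.extend g c₀ 0, fun n => ?_, ?_⟩
  · by_cases hn : ∃ l, g l = n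
    · obtain ⟨l, rfl⟩ := hn
      rw [hg.injective.extend_apply]
      simp only [c₀]
      split_ifs
      exacts [he' _, by norm_num]
    · rw [Function.extend_apply' _ _ _ hn]
      simp
  · have hsub : (Finset.range K).image g ⊆ Finset.Ico 1 N := by
      intro n hn
      obtain ⟨l, hl, rfl⟩ := Finset.mem_image.1 hn
      rw [Finset.mem_range] at hl
      have h1 := hg.monotone (Nat.zero_le l)
      have h2 := hg hl
      rw [Finset.mem_Ico]
      omega
    rw [← Finset.sum_subset hsub, Finset.sum_image fun a _ b _ h => hg.injective h,
      Finset.sum_Ico_eq_sum_range]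
    · refine Finset.sum_congr rfl fun l hl => ?_
      rw [hg.injective.extend_apply, hoff, add_comm 1 l, hheight]
      simp only [c₀]
      rw [if_pos (by simpa using hl)]
    · intro n _ hn
      by_cases h : ∃ l, g l = n
      · obtain ⟨l, rfl⟩ := h
        rw [hg.injective.extend_apply]
        simp only [c₀]
        rw [if_neg, zero_mul]
        intro hl
        exact hn (Finset.mem_image_of_mem g (by simpa using hl))
      · rw [Function.extend_apply' _ _ _ h]
        simp

lemma not_iterate_mem_level (hT : ∀ n : ℕ, 2 ≤ n → (T.height n : ℤ) <
      2 * ((T.height 1 : ℤ) + ∑ k ∈ Finset.Ico 1 n, (T.lastSpacers k : ℤ))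
        + (T.minSpacers n : ℤ) - 1)
    (hS : ∀ n, S.cuts n = 2 ∧ S.spacers n 0 = 0) (hg : StrictMono g)
    (hg0 : 1 ≤ g 0) (hheight : ∀ k, S.height (k + 1) = T.span (g k)) {x y : ℝ}
    (hx : x ∈ T.level 1 0) (hy : y ∈ S.level 1 0) (m : ℕ) (hx' : T.map^[m] x ∈ T.level 1 1)
    (hy' : S.map^[m] y ∈ S.level 1 0) : False := by
  have hT1 := T.two_pow_le_height 1
  have hS1 := S.two_pow_le_height 1
  obtain ⟨n', b', hb', hyb'⟩ := S.exists_mem_level_add_lt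
    (S.column_subset_space 1 (S.mem_column_iff.2 ⟨0, by omega, hy⟩)) m
  obtain ⟨b, hb, hyb⟩ := S.exists_mem_level_not_top_of_le hb' hyb' (Nat.le_succ n')
  obtain ⟨n, a', ha', hxa'⟩ := T.exists_mem_level_add_lt
    (T.column_subset_space 1 (T.mem_column_iff.2 ⟨0, by omega, hx⟩)) m
  obtain ⟨a, ha, hxa⟩ := T.exists_mem_level_not_top_of_le ha' hxa' (le_max_left n (g n'))
  -- The column of `T` is late enough for its stages to include every `g k` used by the digits of
  -- `S`.
  have hN : g n' ≤ max n (g n') := le_max_right _ _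
  generalize max n (g n') = N at *
  have hN1 : 1 ≤ N := hg0.trans ((hg.monotone (Nat.zero_le n')).trans hN)
  obtain ⟨j, hj, hja⟩ := T.exists_digits (by omega) hx hN1 (by omega) hxa
  obtain ⟨j', hj', hja'⟩ := T.exists_digits (by omega) hx' hN1 ha (T.iterate_map_of_mem hxa m ha).2
  obtain ⟨e, he, heb⟩ := S.exists_digits (by omega) hy (by omega) (by omega) hyb
  obtain ⟨e', he', heb'⟩ :=
    S.exists_digits (by omega) hy' (by omega) hb (S.iterate_map_of_mem hyb m hb).2
  obtain ⟨c, hc, hce⟩ := exists_sum_offset_eq hS hg hg0 hheight he hN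
  obtain ⟨c', hc', hce'⟩ := exists_sum_offset_eq hS hg hg0 hheight he' hN
  rw [Nat.succ_eq_add_one, hce] at heb
  rw [Nat.succ_eq_add_one, hce'] at heb'
  have huv := fun n => T.offset_sub_sub_span (hj n) (hj' n) (hc n) (hc' n) rfl
  refine abs_sum_ne_one (T.two_mul_sum_span_le hT) (fun n => (huv n).1) (fun n => (huv n).2) N ?_
  rw [Finset.sum_sub_distrib, Finset.sum_sub_distrib, Finset.sum_sub_distrib]
  zify at hja hja' heb heb'
  rw [abs_eq (by norm_num)]
  -- The time `m` is `1` plus the offset differences for `T`, and the sum of `(c' - c) * span` for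
  -- `S`; hence the sum is `-1`.
  right
  linarith

lemma not_ergodic_prod (hcons : Conservative (Prod.map T.map S.map) (T.measure.prod S.measure))
    (hT : ∀ n : ℕ, 2 ≤ n → (T.height n : ℤ) <
      2 * ((T.height 1 : ℤ) + ∑ k ∈ Finset.Ico 1 n, (T.lastSpacers k : ℤ))
        + (T.minSpacers n : ℤ) - 1)
    (hS : ∀ n, S.cuts n = 2 ∧ S.spacers n 0 = 0) (hg : StrictMono g)
    (hg0 : 1 ≤ g 0) (hheight : ∀ k, S.height (k + 1) = T.span (g k)) :
    ¬ Ergodic (Prod.map T.map S.map) (T.measure.prod S.measure) := by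
  intro herg
  set R := Prod.map T.map S.map with hR
  have hRm : Measurable R := T.measurable_map.prodMap S.measurable_map
  have pos : ∀ (D : CutStack) i, i < D.height 1 → D.measure (D.level 1 i) ≠ 0 := by
    intro D i hi
    have hsub : D.level 1 i ⊆ D.space := fun x hx =>
      D.column_subset_space 1 (D.mem_column_iff.2 ⟨i, hi, hx⟩)
    rw [measure, Measure.restrict_apply (D.measurableSet_level 1 i),
      inter_eq_self_of_subset_left hsub, D.volume_level]
    simpa using D.width_pos 1
  have hT1 := T.two_pow_le_height 1
  have hS1 := S.two_pow_le_height 1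
  have : SigmaFinite S.measure := by unfold measure; infer_instance
  have posA : (T.measure.prod S.measure) (T.level 1 0 ×ˢ S.level 1 0) ≠ 0 := by
    rw [Measure.prod_prod]
    exact mul_ne_zero (pos T 0 (by omega)) (pos S 0 (by omega))
  have posB : (T.measure.prod S.measure) (T.level 1 1 ×ˢ S.level 1 0) ≠ 0 := by
    rw [Measure.prod_prod]
    exact mul_ne_zero (pos T 1 (by omega)) (pos S 0 (by omega))
  have hBm : MeasurableSet (T.level 1 1 ×ˢ S.level 1 0) :=
    (T.measurableSet_level 1 1).prod (S.measurableSet_level 1 0)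
  set B := T.level 1 1 ×ˢ S.level 1 0 with hB
  -- Asking for infinitely many visits, not just one, makes `V` exactly invariant.
  let V : Set (ℝ × ℝ) := {z | ∃ᶠ m in atTop, R^[m] z ∈ B}
  have hVm : MeasurableSet V := by
    have : V = limsup (fun m => R^[m] ⁻¹' B) atTop := by
      rw [limsup_eq_iInf_iSup_of_nat]
      ext z
      simp [V, frequently_atTop]
    rw [this]
    exact MeasurableSet.measurableSet_limsup fun m => hRm.iterate m hBm
  have hVinv : R ⁻¹' V = V := by
    ext z
    simp only [V, mem_preimage, mem_ofPred_eq, ← Function.iterate_succ_apply]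
    rw [← frequently_map (m := fun m : ℕ => m + 1) (P := fun m => R^[m] z ∈ B)]
    rw [map_add_atTop_eq_nat]
  rcases herg.toPreErgodic.aeconst_set hVm hVinv |> eventuallyConst_set.1 with h | h
  · refine posA (measure_mono_null (fun z hz => ?_) (mem_ae_iff.1 h))
    intro hzV
    obtain ⟨m, hm⟩ := Frequently.exists hzV
    rw [hR, Prod.map_iterate] at hm
    exact not_iterate_mem_level hT hS hg hg0 hheight hz.1 hz.2 m hm.1 hm.2
  -- By conservativity almost every point of `B` returns infinitely often, so `V` cannot be null.
  · refine posB (measure_eq_zero_iff_ae_notMem.2 ?_)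
    filter_upwards [hcons.ae_mem_imp_frequently_image_mem hBm.nullMeasurableSet, h] with z h1 h2 h3
    exact h2 (h1 h3)

end Skyscraper

end CutStack

/-! ### Conservativity of the product -/

lemma tendsto_volume_symmDiff_translate {A : Set (ℝ × ℝ)} (hA : MeasurableSet A)
    (hfin : volume A ≠ ⊤) :
    Tendsto (fun v : ℝ × ℝ => volume (symmDiff ((· + v) ⁻¹' A) A)) (nhds 0) (nhds 0) := by
  let F : C((ℝ × ℝ) × (ℝ × ℝ), ℝ × ℝ) := ⟨fun p => p.2 + p.1, by fun_prop⟩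
  have h := tendsto_measure_symmDiff_preimage_nhds_zero (μ := volume) (ν := volume)
    (F.curry.continuous.tendsto 0) (.of_forall fun v => measurePreserving_add_right volume v)
    (measurePreserving_add_right volume 0) hA.nullMeasurableSet hfin
  have h0 : (F.curry 0) ⁻¹' A = A := by
    ext z
    simp [F]
  rw [h0] at h
  exact h

namespace CutStack

variable (D : CutStack)

/-- The first subcolumn of `C n`, without spacers. -/
def firstPiece (n : ℕ) : Set ℝ := ⋃ i ∈ Finset.range (D.height n), D.level (n + 1) i

lemma iterate_map_of_mem_firstPiece {n : ℕ} {x : ℝ} (hx : x ∈ D.firstPiece n) :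
    D.map^[D.span n] x = x + ((D.cuts n - 1 : ℕ) : ℝ) * D.width (n + 1) := by
  obtain ⟨i, hi, hxi⟩ := mem_iUnion₂.1 hx
  rw [Finset.mem_range] at hi
  have hr : D.cuts n - 1 < D.cuts n := by have := D.cuts_pos n; omega
  have h0 := D.left_offset_add (D.cuts_pos n) hi
  have h1 := D.left_offset_add hr hi
  have h2 := D.offset_add_lt (n := n) (t := i) hr (by omega)
  have h3 : i + D.span n = D.offset n (D.cuts n - 1) + i := by rw [span, add_comm]
  rw [offset_zero, zero_add] at h0
  rw [(D.iterate_map_of_mem hxi _ (h3 ▸ h2)).1, h3, h1, h0]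
  push_cast
  ring

lemma exists_sub_mem_firstPiece {n : ℕ} {x : ℝ} (hx : x ∈ D.column n) :
    ∃ j < D.cuts n, x - j * D.width (n + 1) ∈ D.firstPiece n := by
  obtain ⟨i, hi, hxi⟩ := D.mem_column_iff.1 hx
  obtain ⟨j, hj, hxj⟩ := D.exists_mem_level_succ hi hxi
  refine ⟨j, hj, mem_iUnion₂.2 ⟨i, by simpa using hi, ?_⟩⟩
  have h0 := D.left_offset_add (D.cuts_pos n) hi
  have h1 := D.left_offset_add hj hi
  rw [offset_zero, zero_add] at h0
  rw [level, h1] at hxj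
  rw [level, h0]
  push_cast
  constructor <;> linarith [hxj.1, hxj.2]

lemma natCast_mul_width_succ_le {n j : ℕ} (hj : j < D.cuts n) :
    ‖(j : ℝ) * D.width (n + 1)‖ ≤ D.width n := by
  have hw := D.width_pos (n + 1)
  rw [Real.norm_of_nonneg (by positivity), ← D.cuts_mul_width_succ n]
  exact mul_le_mul_of_nonneg_right (by exact_mod_cast hj.le) hw.le

lemma exists_volume_inter_column_ne_zero {T S : CutStack} {s : Set (ℝ × ℝ)}
    (hs : (T.measure.prod S.measure) s ≠ 0) :
    ∃ N, volume (s ∩ T.column N ×ˢ S.column N) ≠ 0 := by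
  by_contra! hcon
  refine hs ?_
  rw [measure, measure, Measure.prod_restrict, ← Measure.volume_eq_prod,
    Measure.restrict_apply' (T.measurableSet_space.prod S.measurableSet_space)]
  refine measure_mono_null ?_ (measure_iUnion_null hcon)
  rintro z ⟨hz, hz1, hz2⟩
  obtain ⟨n1, h1⟩ := mem_iUnion.1 hz1
  obtain ⟨n2, h2⟩ := mem_iUnion.1 hz2
  exact mem_iUnion.2 ⟨max n1 n2, hz, T.column_mono (le_max_left _ _) h1,
    S.column_mono (le_max_right _ _) h2⟩

lemma volume_column_prod_ne_top (T S : CutStack) (N : ℕ) :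
    volume (T.column N ×ˢ S.column N) ≠ ⊤ := by
  rw [Measure.volume_eq_prod, Measure.prod_prod, column_eq, column_eq]
  exact ENNReal.mul_ne_top measure_Ico_lt_top.ne measure_Ico_lt_top.ne

/-- Two rank-one transformations, the first with bounded cuts, whose spans agree along
subsequences tending to infinity, the second one being cut into two at these stages, have a
conservative product. -/
lemma conservative_prod {T S : CutStack} (hcuts : T.BoundedCuts) {g g' : ℕ → ℕ}
    (hg : Tendsto g atTop atTop) (hg' : Tendsto g' atTop atTop)
    (hS : S.BoundedCuts) (hspan : ∀ k, T.span (g k) = S.span (g' k)) :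
    Conservative (Prod.map T.map S.map) (T.measure.prod S.measure) := by
  have : SigmaFinite S.measure := by unfold measure; infer_instance
  have : SigmaFinite T.measure := by unfold measure; infer_instance
  refine ⟨(T.measurePreserving_map.prod S.measurePreserving_map).quasiMeasurePreserving,
    fun s hs h0 => ?_⟩
  obtain ⟨N, hN⟩ := exists_volume_inter_column_ne_zero h0
  obtain ⟨P, hP⟩ := hcuts
  obtain ⟨Q, hQ⟩ := hS
  replace hP : ∀ n, T.cuts n ≤ P := fun n => hP (mem_range_self n)
  replace hQ : ∀ n, S.cuts n ≤ Q := fun n => hQ (mem_range_self n)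
  set A := s ∩ T.column N ×ˢ S.column N with hA
  have hAm : MeasurableSet A := hs.inter ((T.measurableSet_column N).prod (S.measurableSet_column N))
  have hAfin : volume A ≠ ⊤ :=
    ne_top_of_le_ne_top (volume_column_prod_ne_top T S N) (measure_mono inter_subset_right)
  -- There will be at most `P * Q` pieces, each of measure at most `ε + ε`.
  obtain ⟨ε, hε, hεA⟩ : ∃ ε > 0, ((P * Q * 2 : ℕ) : ENNReal) * ε < volume A := by
    refine ⟨volume A / ((P * Q * 2 + 1 : ℕ) : ENNReal),
      ENNReal.div_pos hN (ENNReal.natCast_ne_top _), ?_⟩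
    rw [← mul_div_assoc]
    refine ENNReal.div_lt_of_lt_mul ?_
    rw [mul_comm]
    exact ENNReal.mul_lt_mul_right hN hAfin (by exact_mod_cast Nat.lt_succ_self _)
  obtain ⟨δ, hδ, hball⟩ := Metric.eventually_nhds_iff.1
    ((tendsto_volume_symmDiff_translate hAm hAfin).eventually_lt_const hε)
  obtain ⟨k, hk1, hk2, hk3, hk4⟩ := (((T.tendsto_width.comp hg).eventually_lt_const hδ).and
    (((S.tendsto_width.comp hg').eventually_lt_const hδ).and
      ((hg.eventually_ge_atTop N).and (hg'.eventually_ge_atTop N)))).exists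
  simp only [Function.comp_apply] at hk1 hk2
  let u : ℕ → ℕ → ℝ × ℝ := fun j l => (j * T.width (g k + 1), l * S.width (g' k + 1))
  have hu : ∀ j < T.cuts (g k), ∀ l < S.cuts (g' k),
      volume (symmDiff ((· + u j l) ⁻¹' A) A) < ε := fun j hj l hl => by
    refine hball ?_
    rw [dist_zero_right, Prod.norm_def]
    exact max_lt ((T.natCast_mul_width_succ_le hj).trans_lt hk1)
      ((S.natCast_mul_width_succ_le hl).trans_lt hk2)
  set E := T.firstPiece (g k) ×ˢ S.firstPiece (g' k) with hE
  by_contra! hcon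
  -- On `E` the iterate at time `span` is translation by the last `u j l`; without returns it takes
  -- `A ∩ E` out of `A`.
  have hAE : volume (A ∩ E) ≤ ε := by
    have hr := T.cuts_pos (g k)
    have hr' := S.cuts_pos (g' k)
    refine (measure_mono fun z hz => ?_).trans
      (hu (T.cuts (g k) - 1) (by omega) (S.cuts (g' k) - 1) (by omega)).le
    refine Or.inr ⟨hz.1, fun hzu => ?_⟩
    refine hcon z hz.1.1 (T.span (g k)) ?_ ?_
    · have := T.height_le_span (g k)
      have := T.height_pos (g k)
      omega
    · have : (Prod.map T.map S.map)^[T.span (g k)] z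
          = z + u (T.cuts (g k) - 1) (S.cuts (g' k) - 1) := by
        rw [Prod.map_iterate]
        refine Prod.ext (T.iterate_map_of_mem_firstPiece hz.2.1) ?_
        simp only [Prod.map_snd]
        rw [hspan, S.iterate_map_of_mem_firstPiece hz.2.2]
        rfl
      rw [this]
      exact hzu.1
  have hcover : A ⊆ ⋃ j ∈ Finset.range (T.cuts (g k)), ⋃ l ∈ Finset.range (S.cuts (g' k)),
      {z | z ∈ A ∧ z - u j l ∈ E} := by
    intro z hz
    obtain ⟨j, hj, hzj⟩ := T.exists_sub_mem_firstPiece (T.column_mono hk3 hz.2.1)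
    obtain ⟨l, hl, hzl⟩ := S.exists_sub_mem_firstPiece (S.column_mono hk4 hz.2.2)
    exact mem_iUnion₂.2 ⟨j, by simpa using hj, mem_iUnion₂.2 ⟨l, by simpa using hl, hz, hzj, hzl⟩⟩
  -- Translated back by `u j l`, the piece lies in `E`, and in `A` up to measure `ε`.
  have hpiece : ∀ j < T.cuts (g k), ∀ l < S.cuts (g' k),
      volume {z | z ∈ A ∧ z - u j l ∈ E} ≤ ε + ε := fun j hj l hl => by
    rw [← measure_preimage_add_right volume (u j l)]
    refine (measure_mono ?_).trans ((measure_union_le (A ∩ E)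
      (symmDiff ((· + u j l) ⁻¹' A) A)).trans (add_le_add hAE (hu j hj l hl).le))
    rintro z ⟨h1, h2⟩
    rw [add_sub_cancel_right] at h2
    by_cases hzA : z ∈ A
    · exact Or.inl ⟨hzA, h2⟩
    · exact Or.inr (Or.inl ⟨h1, hzA⟩)
  refine hεA.not_ge ((measure_mono hcover).trans ?_)
  calc _ ≤ ∑ j ∈ Finset.range (T.cuts (g k)), ∑ l ∈ Finset.range (S.cuts (g' k)),
        volume {z | z ∈ A ∧ z - u j l ∈ E} :=
        (measure_biUnion_finset_le _ _).trans
          (Finset.sum_le_sum fun _ _ => measure_biUnion_finset_le _ _)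
    _ ≤ ∑ j ∈ Finset.range (T.cuts (g k)), ∑ l ∈ Finset.range (S.cuts (g' k)), (ε + ε) :=
        Finset.sum_le_sum fun j hj => Finset.sum_le_sum fun l hl =>
          hpiece j (by simpa using hj) l (by simpa using hl)
    _ = ((T.cuts (g k) * S.cuts (g' k) * 2 : ℕ) : ENNReal) * ε := by
        simp only [Finset.sum_const, Finset.card_range, nsmul_eq_mul]
        push_cast
        ring
    _ ≤ _ := by
        have h1 := hP (g k)
        have h2 := hQ (g' k)
        gcongr

end CutStack

/-! ### Construction of the skyscraper -/

namespace CutStack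

/-- Spans are unbounded, being at least `2 ^ n`. The summands `2 ^ (k + 2)` make the skyscraper fill
`[0, ∞)`; `4` is the same bound after height 1, and `1 ≤ g 0` because digits start at stage 1. -/
lemma exists_span_subsequence (T : CutStack) : ∃ g : ℕ → ℕ, StrictMono g ∧ 1 ≤ g 0 ∧
    4 ≤ T.span (g 0) ∧ ∀ k, 2 * T.span (g k) + 2 ^ (k + 2) ≤ T.span (g (k + 1)) := by
  have hex : ∀ v n : ℕ, ∃ n' > n, v ≤ T.span n' := fun v n =>
    ⟨max v (n + 1), by omega, ((Nat.lt_two_pow_self (n := v)).le.trans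
      (Nat.pow_le_pow_right (by norm_num) (le_max_left _ _))).trans
      ((T.two_pow_le_height _).trans (T.height_le_span _))⟩
  choose next hnext hspan using hex
  let g : ℕ → ℕ := fun k =>
    Nat.rec (next 4 0) (fun k n => next (2 * T.span n + 2 ^ (k + 2)) n) k
  exact ⟨g, strictMono_nat_of_lt_succ fun k => hnext _ _, hnext _ _, hspan _ _,
    fun k => hspan _ _⟩

/-- The skyscraper construction with prescribed heights `H`, where `H 0 = 1`. -/
def skyscraper (H : ℕ → ℕ) : CutStack where
  cuts _ := 2
  spacers n j := if j = 0 then 0 else H (n + 1) - 2 * H n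
  two_le_cuts _ := le_rfl

lemma height_skyscraper {H : ℕ → ℕ} (h0 : H 0 = 1) (hH : ∀ n, 2 * H n ≤ H (n + 1)) (n : ℕ) :
    (skyscraper H).height n = H n := by
  induction n with
  | zero => exact h0.symm
  | succ n ih =>
    have := hH n
    simp only [height, skyscraper, Finset.sum_range_succ, Finset.sum_range_zero] at ih ⊢
    rw [ih]
    simp
    omega

lemma width_skyscraper (H : ℕ → ℕ) (n : ℕ) : (skyscraper H).width n = (1 / 2) ^ n := by
  induction n with
  | zero => simp [width]
  | succ n ih =>
    rw [width, ih, pow_succ]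
    simp [skyscraper]
    ring

lemma isSkyscraper_skyscraper {H : ℕ → ℕ} (h0 : H 0 = 1)
    (hH : ∀ n, 2 * H n + 2 ^ (n + 1) ≤ H (n + 1)) : (skyscraper H).IsSkyscraper := by
  refine ⟨fun n => ⟨rfl, rfl⟩, subset_antisymm ?_ ?_⟩
  · refine iUnion_subset fun n => ?_
    rw [column_eq]
    exact Ico_subset_Ici_self
  · intro x hx
    -- With width `2 ^ (-n)`, this makes column `n` contain `[0, n]`.
    have grow : ∀ n : ℕ, n * 2 ^ n < H n := fun n => by
      induction n with
      | zero => simp [h0]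
      | succ n ih =>
        have := hH n
        rw [pow_succ] at this ⊢
        nlinarith
    obtain ⟨n, hn⟩ := exists_nat_gt x
    refine mem_iUnion.2 ⟨n, ?_⟩
    rw [column_eq, width_skyscraper, height_skyscraper h0 fun n => (Nat.le_add_right _ _).trans (hH n)]
    refine ⟨hx, hn.trans ?_⟩
    rw [one_div, inv_pow, ← div_eq_mul_inv, lt_div_iff₀ (by positivity)]
    exact_mod_cast grow n

end CutStack

theorem mainTheorem5 (T : CutStack) (hcuts : T.BoundedCuts)
    (hT : ∀ n : ℕ, 2 ≤ n →
      (T.height n : ℤ) <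
        2 * ((T.height 1 : ℤ) + ∑ k ∈ Finset.Ico 1 n, (T.lastSpacers k : ℤ))
          + (T.minSpacers n : ℤ) - 1) :
    ∃ S : CutStack, S.IsSkyscraper ∧
      MeasurePreserving (Prod.map T.map S.map) (T.measure.prod S.measure)
        (T.measure.prod S.measure) ∧
      Conservative (Prod.map T.map S.map) (T.measure.prod S.measure) ∧
      ¬ Ergodic (Prod.map T.map S.map) (T.measure.prod S.measure) := by
  obtain ⟨g, hg, hg0, hspan0, hspan⟩ := T.exists_span_subsequence
  -- Heights are shifted by one stage because `C 0` must have height 1.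
  let H : ℕ → ℕ := fun n => Nat.casesOn n 1 fun k => T.span (g k)
  have hH : ∀ n, 2 * H n + 2 ^ (n + 1) ≤ H (n + 1)
    | 0 => hspan0
    | n + 1 => hspan n
  set S := CutStack.skyscraper H
  have hS : S.IsSkyscraper := CutStack.isSkyscraper_skyscraper rfl hH
  have hheight : ∀ k, S.height (k + 1) = T.span (g k) := fun k =>
    CutStack.height_skyscraper rfl (fun n => (Nat.le_add_right _ _).trans (hH n)) (k + 1)
  have hSspan : ∀ n, S.span n = S.height n := fun n => by
    rw [CutStack.span, (hS.1 n).1]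
    simpa [CutStack.offset_zero, (hS.1 n).2] using S.offset_succ n 0
  have hScuts : S.BoundedCuts := ⟨2, by rintro _ ⟨n, rfl⟩; exact (hS.1 n).1.le⟩
  have hcons : Conservative (Prod.map T.map S.map) (T.measure.prod S.measure) :=
    CutStack.conservative_prod hcuts hg.tendsto_atTop (tendsto_add_atTop_nat 1) hScuts
      fun k => by rw [hSspan, hheight]
  have : SigmaFinite S.measure := by unfold CutStack.measure; infer_instance
  have : SigmaFinite T.measure := by unfold CutStack.measure; infer_instance
  exact ⟨S, hS, T.measurePreserving_map.prod S.measurePreserving_map, hcons,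
    CutStack.not_ergodic_prod hcons hT hS.1 hg hg0 hheight⟩
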